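/- Let $(X,d)$ be a compact metric space with at least two points and let $f\colon X\to X$ be a continuous surjection that is equicontinuous: for every $\varepsilon>0$ there is $\delta>0$ such that $d(x,y)<\delta$ implies $d(f^n(x),f^n(y))<\varepsilon$ for all $n\ge 0$. Then $f$ has neither the $\underline d$-shadowing property nor the $\overline d$-shadowing property. Here, for $A\subset\{0,1,2,\dots\}$, $\underline d(A)$ and $\overline d(A)$ denote the $\liminf$ and the $\limsup$, as $n\to\infty$, of $\frac1n|A\cap\{0,\dots,n-1\}|$. For $\delta>0$, a sequence $(x_i)_{i\ge0}$ in $X$ is a $\delta$-ergodic pseudo-orbit of $f$ if $\lim_{n\to\infty}\frac1n|\{0\le i<n : d(f(x_i),x_{i+1})\ge\delta\}|=0$. The map $f$ has the $\underline d$-shadowing property (respectively, the $\overline d$-shadowing property) if for every $\varepsilon>0$ there is $\delta>0$ such that for every $\delta$-ergodic pseudo-orbit $(x_i)_{i\ge0}$ of $f$ there is a point $z\in X$ for which the set $\Lambda=\{i\ge0 : d(f^i(z),x_i)<\varepsilon\}$ satisfies $\underline d(\Lambda)>0$ (respectively, $\overline d(\Lambda)>1/2$). -/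

import Mathlib

open Filter Topology

/-- The upper density `limsup (1/n) |A ∩ {0, …, n-1}|` of a set of nonnegative integers.
The sequence takes values in `[0, 1]`, so the real `limsup` is the genuine one. -/
noncomputable def upperDensity (A : Set ℕ) : ℝ :=
  limsup (fun n : ℕ => ((A ∩ Set.Iio n).ncard : ℝ) / n) atTop

/-- The lower density `liminf (1/n) |A ∩ {0, …, n-1}|` of a set of nonnegative integers. -/
noncomputable def lowerDensity (A : Set ℕ) : ℝ :=
  liminf (fun n : ℕ => ((A ∩ Set.Iio n).ncard : ℝ) / n) atTop

/-- The family of all sets of nonnegative integers with lower density greater than `α`. -/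
def lowerDensityFamily (α : ℝ) : Set (Set ℕ) := {A | α < lowerDensity A}

/-- The family of all sets of nonnegative integers with upper density greater than `α`. -/
def upperDensityFamily (α : ℝ) : Set (Set ℕ) := {A | α < upperDensity A}

/-- The sequence `x` is a `δ`-ergodic pseudo-orbit of `f`: the set of times `i` with
`d (f (x i), x (i + 1)) ≥ δ` has density zero. -/
def IsErgodicPseudoOrbit {X : Type*} [MetricSpace X] (f : X → X) (δ : ℝ) (x : ℕ → X) : Prop :=
  Tendsto (fun n : ℕ => (({i : ℕ | δ ≤ dist (f (x i)) (x (i + 1))} ∩ Set.Iio n).ncard : ℝ) / n)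
    atTop (𝓝 0)

/-- The set of times at which the orbit of `z` under `f` is `ε`-close to the sequence `x`. -/
def tracingTimes {X : Type*} [MetricSpace X] (f : X → X) (z : X) (x : ℕ → X) (ε : ℝ) : Set ℕ :=
  {i | dist (f^[i] z) (x i) < ε}

/-- The (ergodic) shadowing property with respect to a family `F` of sets of nonnegative
integers. -/
def HasFamilyShadowing {X : Type*} [MetricSpace X] (F : Set (Set ℕ)) (f : X → X) : Prop :=
  ∀ ε : ℝ, 0 < ε → ∃ δ : ℝ, 0 < δ ∧ ∀ x : ℕ → X, IsErgodicPseudoOrbit f δ x →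
    ∃ z : X, tracingTimes f z x ε ∈ F

/-- The lower density shadowing property: tracing on a set of positive lower density. -/
def HasLowerDensityShadowing {X : Type*} [MetricSpace X] (f : X → X) : Prop :=
  HasFamilyShadowing (lowerDensityFamily 0) f

/-- The upper density shadowing property: tracing on a set of upper density greater than
one half. -/
def HasUpperDensityShadowing {X : Type*} [MetricSpace X] (f : X → X) : Prop :=
  HasFamilyShadowing (upperDensityFamily (1 / 2)) f

/-- The map `f` is equicontinuous: for every `ε > 0` there is `δ > 0` such that
`d (x, y) < δ` implies `d (f^n x, f^n y) < ε` for all `n ≥ 0`. -/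
def IsEquicontinuousMap {X : Type*} [MetricSpace X] (f : X → X) : Prop :=
  UniformEquicontinuous (fun n : ℕ => f^[n])

/-! Compactness and surjectivity turn equicontinuity around: orbits of distinct points `a`, `b` stay
uniformly apart, so no orbit comes `ε`-close to both, even at different times
(`IsEquicontinuousMap.dist_lt_of_dist_iterate_lt`). Splice the two orbits, switching on a set of
times of density zero: a tracing point then sees only one of the two parts. Switching at squares
gives both parts density 1/2, which excludes upper density above 1/2; switching at `2 ^ k²` makes
each block dwarf its past, so both parts have lower density 0. -/

/-- An equicontinuous surjection of a compact space returns a given point arbitrarily close to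
itself; here for two points simultaneously, at an arbitrarily late time. -/
theorem IsEquicontinuousMap.exists_return {X : Type*} [MetricSpace X] [CompactSpace X]
    {f : X → X} (hequi : IsEquicontinuousMap f) (hsurj : Function.Surjective f)
    {ε : ℝ} (hε : 0 < ε) (N : ℕ) (x y : X) :
    ∃ p, N ≤ p ∧ dist x (f^[p] x) < ε ∧ dist y (f^[p] y) < ε := by
  obtain ⟨δ, hδ, h⟩ := Metric.uniformEquicontinuous_iff.1 hequi ε hε
  obtain ⟨g, hg⟩ := hsurj.hasRightInverse
  have hgn : ∀ n, Function.RightInverse g^[n] f^[n] := fun n => hg.iterate n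
  -- Two close points of the backward orbit, pushed forward by the larger of their two times, become
  -- a point and its return; working in `X × X` gives a common return time.
  obtain ⟨c, -, φ, hφ, hlim⟩ := (isCompact_univ (X := X × X)).tendsto_subseq
    (x := fun n => (g^[n] x, g^[n] y)) (fun _ => Set.mem_univ _)
  obtain ⟨K, hK⟩ := Metric.cauchySeq_iff.1 hlim.cauchySeq δ hδ
  have hle : φ K + N ≤ φ (K + N) := by
    have := hφ.add_le_nat N K
    rw [add_comm N K] at this
    omega
  have hd := hK (K + N) (by omega) K le_rfl
  rw [Function.comp_apply, Function.comp_apply, Prod.dist_eq, max_lt_iff] at hd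
  have key : ∀ w : X, f^[φ (K + N)] (g^[φ K] w) = f^[φ (K + N) - φ K] w := fun w => by
    conv_lhs => rw [← Nat.sub_add_cancel (show φ K ≤ φ (K + N) by omega)]
    rw [Function.iterate_add_apply, hgn]
  refine ⟨φ (K + N) - φ K, by omega, ?_, ?_⟩
  · simpa only [key, hgn _ x] using h _ _ hd.1 (φ (K + N))
  · simpa only [key, hgn _ y] using h _ _ hd.2 (φ (K + N))

/-- The inverse iterates of an equicontinuous surjection of a compact space are uniformly
equicontinuous. -/
theorem IsEquicontinuousMap.dist_lt_of_dist_iterate_lt {X : Type*} [MetricSpace X]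
    [CompactSpace X] {f : X → X} (hequi : IsEquicontinuousMap f)
    (hsurj : Function.Surjective f) {ε : ℝ} (hε : 0 < ε) :
    ∃ δ > 0, ∀ (i : ℕ) (x y : X), dist (f^[i] x) (f^[i] y) < δ → dist x y < ε := by
  obtain ⟨δ, hδ, h⟩ := Metric.uniformEquicontinuous_iff.1 hequi (ε / 3) (by positivity)
  refine ⟨δ, hδ, fun i x y hxy => ?_⟩
  obtain ⟨p, hp, hx, hy⟩ := hequi.exists_return hsurj (show 0 < ε / 3 by positivity) i x y
  -- Closeness at time `i` persists to the common return time `p ≥ i`.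
  have h1 := h _ _ hxy (p - i)
  rw [← Function.iterate_add_apply, ← Function.iterate_add_apply, Nat.sub_add_cancel hp] at h1
  have h2 := dist_triangle4 x (f^[p] x) (f^[p] y) y
  rw [dist_comm (f^[p] y) y] at h2
  linarith

/-! ### Splicing two orbits -/

theorem tendsto_natSqrt_div_atTop :
    Tendsto (fun n : ℕ => (Nat.sqrt n : ℝ) / n) atTop (𝓝 0) := by
  have h : Tendsto (fun n : ℕ => (√(n : ℝ))⁻¹) atTop (𝓝 0) :=
    tendsto_inv_atTop_zero.comp (Real.tendsto_sqrt_atTop.comp tendsto_natCast_atTop_atTop)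
  refine squeeze_zero (fun n => by positivity) (fun n => ?_) h
  calc (Nat.sqrt n : ℝ) / n ≤ √(n : ℝ) / n := by gcongr; exact Real.nat_sqrt_le_real_sqrt
    _ = (√(n : ℝ))⁻¹ := Real.sqrt_div_self

/-- A monotone sequence of natural numbers jumps at most `g n` times before time `n`. -/
theorem Monotone.ncard_jumps_le {g : ℕ → ℕ} (hg : Monotone g) (n : ℕ) :
    ({i | g i ≠ g (i + 1)} ∩ Set.Iio n).ncard ≤ g n := by
  have hlt : ∀ i, g i ≠ g (i + 1) → ∀ j, i < j → g i < g j := fun i hi j hij =>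
    (lt_of_le_of_ne (hg i.le_succ) hi).trans_le (hg hij)
  have := Set.ncard_le_ncard_of_injOn (t := Set.Iio (g n)) g
    (s := {i | g i ≠ g (i + 1)} ∩ Set.Iio n)
    (fun i hi => hlt i hi.1 n hi.2)
    (fun i hi j hj hij => by
      rcases lt_trichotomy i j with h | h | h
      · exact absurd hij (hlt i hi.1 j h).ne
      · exact h
      · exact absurd hij (hlt j hj.1 i h).ne')
    (Set.finite_Iio _)
  simpa [Set.ncard_eq_toFinset_card'] using this

/-- Follow the orbit of `a` while `g` is even and the orbit of `b` while `g` is odd. -/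
def alternatingOrbit {X : Type*} (f : X → X) (a b : X) (g : ℕ → ℕ) (i : ℕ) : X :=
  if Even (g i) then f^[i] a else f^[i] b

theorem isErgodicPseudoOrbit_alternatingOrbit {X : Type*} [MetricSpace X] (f : X → X) (a b : X)
    {g : ℕ → ℕ} (hg : Monotone g) (hsqrt : ∀ n, g n ≤ Nat.sqrt n) {δ : ℝ} (hδ : 0 < δ) :
    IsErgodicPseudoOrbit f δ (alternatingOrbit f a b g) := by
  refine squeeze_zero (fun n => by positivity) (fun n => ?_) tendsto_natSqrt_div_atTop
  gcongr
  refine le_trans (Set.ncard_le_ncard ?_ ((Set.finite_Iio n).inter_of_right _))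
    ((hg.ncard_jumps_le n).trans (hsqrt n))
  -- Where `g` does not jump, the sequence follows a true orbit, with zero error.
  refine Set.inter_subset_inter_left _ fun i hi heq => hδ.not_ge (le_of_le_of_eq hi ?_)
  simp only [alternatingOrbit, ← heq]
  split_ifs <;> rw [Function.iterate_succ_apply', dist_self]

/-- If orbits separate `a` and `b` uniformly, an orbit can only trace one of the two parts of
the alternating sequence. -/
theorem tracingTimes_alternatingOrbit_subset {X : Type*} [MetricSpace X] {f : X → X} {a b : X}
    {ε : ℝ} (h : ∀ (i : ℕ) (x y : X), dist (f^[i] x) (f^[i] y) < ε → dist x y < dist a b / 2)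
    (g : ℕ → ℕ) (z : X) :
    tracingTimes f z (alternatingOrbit f a b g) ε ⊆ {i | Even (g i)} ∨
      tracingTimes f z (alternatingOrbit f a b g) ε ⊆ {i | ¬ Even (g i)} := by
  by_contra! hcon
  obtain ⟨⟨i, hi, hi'⟩, ⟨j, hj, hj'⟩⟩ := And.imp Set.not_subset.1 Set.not_subset.1 hcon
  simp only [Set.mem_ofPred_eq, not_not] at hi' hj'
  simp only [tracingTimes, alternatingOrbit, Set.mem_ofPred_eq, if_neg hi'] at hi
  simp only [tracingTimes, alternatingOrbit, Set.mem_ofPred_eq, if_pos hj'] at hj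
  -- Pulled back to time 0, both estimates put `z` within half of `dist a b` of `a` and of `b`.
  have h1 := h _ _ _ hi
  have h2 := h _ _ _ hj
  have := dist_triangle_left a b z
  linarith

/-- A map with uniformly injective iterates has no shadowing property for a family which contains
no subset of either part of some slowly alternating partition of the times. -/
theorem not_hasFamilyShadowing_of_alternating {X : Type*} [MetricSpace X] [CompactSpace X]
    [Nontrivial X] {f : X → X} (hsurj : Function.Surjective f) (hequi : IsEquicontinuousMap f)
    {F : Set (Set ℕ)} {g : ℕ → ℕ} (hg : Monotone g) (hsqrt : ∀ n, g n ≤ Nat.sqrt n)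
    (heven : ∀ A ⊆ {i | Even (g i)}, A ∉ F) (hodd : ∀ A ⊆ {i | ¬ Even (g i)}, A ∉ F) :
    ¬ HasFamilyShadowing F f := by
  intro hF
  obtain ⟨a, b, hab⟩ := exists_pair_ne X
  obtain ⟨ε, hε, h⟩ := hequi.dist_lt_of_dist_iterate_lt hsurj
    (show 0 < dist a b / 2 from half_pos (dist_pos.2 hab))
  obtain ⟨δ, hδ, hsh⟩ := hF ε hε
  obtain ⟨z, hz⟩ := hsh _ (isErgodicPseudoOrbit_alternatingOrbit f a b hg hsqrt hδ)
  rcases tracingTimes_alternatingOrbit_subset h g z with hs | hs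
  · exact heven _ hs hz
  · exact hodd _ hs hz

/-! ### Densities of the two parts -/

theorem isBoundedUnder_ge_ncard_div (A : Set ℕ) : IsBoundedUnder (· ≥ ·) atTop
    (fun n : ℕ => ((A ∩ Set.Iio n).ncard : ℝ) / n) :=
  isBoundedUnder_of ⟨0, fun n => by positivity⟩

theorem ncard_inter_Iio_succ (A : Set ℕ) [DecidablePred (· ∈ A)] (n : ℕ) :
    (A ∩ Set.Iio (n + 1)).ncard = (A ∩ Set.Iio n).ncard + if n ∈ A then 1 else 0 := by
  have hsucc : Set.Iio (n + 1) = insert n (Set.Iio n) := by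
    ext i; simp only [Set.mem_Iio, Set.mem_insert_iff]; omega
  rw [hsucc]
  split_ifs with h
  · rw [Set.inter_insert_of_mem h, Set.ncard_insert_of_notMem (fun hn => lt_irrefl n hn.2)
      ((Set.finite_Iio n).inter_of_right _)]
  · rw [Set.inter_insert_of_notMem h, add_zero]

/-- The left side counts even minus odd times. Block `k` has length `2k + 1`; with `m = Nat.sqrt n`,
the complete blocks give `1 - 3 + 5 - ⋯ = ±m`, and the current one adds `∓(n - m²)`. -/
theorem two_mul_ncard_even_sqrt (n : ℕ) :
    (2 * (({i | Even (Nat.sqrt i)} ∩ Set.Iio n).ncard : ℤ) - n =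
      if Even (Nat.sqrt n) then (n : ℤ) - Nat.sqrt n ^ 2 - Nat.sqrt n
      else Nat.sqrt n ^ 2 + Nat.sqrt n - n) := by
  induction n with
  | zero => simp
  | succ n ih =>
    rw [ncard_inter_Iio_succ]
    simp only [Set.mem_ofPred_eq]
    have h1 := Nat.sqrt_le' n
    have h2 := Nat.lt_succ_sqrt' n
    rcases Nat.lt_or_ge (n + 1) ((Nat.sqrt n + 1) ^ 2) with h | h
    · have hs : Nat.sqrt (n + 1) = Nat.sqrt n := by
        rw [Nat.eq_sqrt'.2 ⟨h1.trans n.le_succ, h⟩ |>.symm]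
      rw [hs]
      split_ifs at ih ⊢ <;> push_cast <;> linarith
    · have hn : n + 1 = (Nat.sqrt n + 1) ^ 2 := le_antisymm h2 h
      have hs : Nat.sqrt (n + 1) = Nat.sqrt n + 1 := by rw [hn, Nat.sqrt_eq']
      have hn' : (n : ℤ) = (Nat.sqrt n + 1) ^ 2 - 1 := by
        rw [eq_sub_iff_add_eq]; exact_mod_cast hn
      rw [hs]
      simp only [Nat.even_add_one]
      split_ifs at ih ⊢ <;> first | contradiction | (push_cast; linarith)

theorem abs_two_mul_ncard_even_sqrt_sub_le (n : ℕ) :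
    |2 * (({i | Even (Nat.sqrt i)} ∩ Set.Iio n).ncard : ℝ) - n| ≤ Nat.sqrt n := by
  have h1 : (Nat.sqrt n : ℤ) ^ 2 ≤ n := by exact_mod_cast Nat.sqrt_le' n
  have h2 : (n : ℤ) ≤ Nat.sqrt n ^ 2 + 2 * Nat.sqrt n := by
    have : (n : ℤ) + 1 ≤ (Nat.sqrt n + 1) ^ 2 := by exact_mod_cast Nat.lt_succ_sqrt' n
    linarith
  have key : |2 * (({i | Even (Nat.sqrt i)} ∩ Set.Iio n).ncard : ℤ) - n| ≤ Nat.sqrt n := by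
    rw [two_mul_ncard_even_sqrt, abs_le]
    split_ifs <;> constructor <;> linarith
  exact_mod_cast key

theorem ncard_add_ncard_compl_inter_Iio (A : Set ℕ) (n : ℕ) :
    (A ∩ Set.Iio n).ncard + (Aᶜ ∩ Set.Iio n).ncard = n := by
  have h := Set.ncard_inter_add_ncard_sdiff_eq_ncard (Set.Iio n) A (Set.finite_Iio n)
  rw [Set.inter_comm, Set.sdiff_eq, Set.inter_comm _ Aᶜ] at h
  simpa [Set.ncard_eq_toFinset_card'] using h

theorem upperDensity_le_half_of_ncard_le {A : Set ℕ}
    (h : ∀ n : ℕ, 2 * ((A ∩ Set.Iio n).ncard : ℝ) - n ≤ Nat.sqrt n) :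
    upperDensity A ≤ 1 / 2 := by
  have hlim : Tendsto (fun n : ℕ => 1 / 2 + 1 / 2 * ((Nat.sqrt n : ℝ) / n)) atTop
      (𝓝 (1 / 2)) := by
    simpa only [mul_zero, add_zero] using
      (tendsto_natSqrt_div_atTop.const_mul (1 / 2 : ℝ)).const_add (1 / 2)
  rw [← hlim.limsup_eq]
  refine limsup_le_limsup ?_ (isBoundedUnder_ge_ncard_div A).isCoboundedUnder_le
    hlim.isBoundedUnder_le
  filter_upwards [eventually_gt_atTop 0] with n hn
  have hn' : (0 : ℝ) < n := by exact_mod_cast hn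
  rw [div_le_iff₀ hn']
  field_simp
  linarith [h n]

theorem ncard_inter_Iio_mono {A B : Set ℕ} (h : A ⊆ B) (n : ℕ) :
    (A ∩ Set.Iio n).ncard ≤ (B ∩ Set.Iio n).ncard :=
  Set.ncard_le_ncard (Set.inter_subset_inter_left _ h) ((Set.finite_Iio n).inter_of_right _)

theorem upperDensity_le_half_of_subset_even_sqrt {A : Set ℕ}
    (hA : A ⊆ {i | Even (Nat.sqrt i)}) : upperDensity A ≤ 1 / 2 :=
  upperDensity_le_half_of_ncard_le fun n => by
    have h1 : ((A ∩ Set.Iio n).ncard : ℝ) ≤ ({i | Even (Nat.sqrt i)} ∩ Set.Iio n).ncard := by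
      exact_mod_cast ncard_inter_Iio_mono hA n
    linarith [(abs_le.1 (abs_two_mul_ncard_even_sqrt_sub_le n)).2]

theorem upperDensity_le_half_of_subset_not_even_sqrt {A : Set ℕ}
    (hA : A ⊆ {i | ¬ Even (Nat.sqrt i)}) : upperDensity A ≤ 1 / 2 :=
  upperDensity_le_half_of_ncard_le fun n => by
    have h1 : ((A ∩ Set.Iio n).ncard : ℝ) ≤ ({i | Even (Nat.sqrt i)}ᶜ ∩ Set.Iio n).ncard := by
      exact_mod_cast ncard_inter_Iio_mono hA n
    have h2 : (({i | Even (Nat.sqrt i)} ∩ Set.Iio n).ncard : ℝ)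
        + ({i | Even (Nat.sqrt i)}ᶜ ∩ Set.Iio n).ncard = n := by
      exact_mod_cast ncard_add_ncard_compl_inter_Iio _ n
    linarith [(abs_le.1 (abs_two_mul_ncard_even_sqrt_sub_le n)).1]

theorem sqrt_log_eq {k i : ℕ} (h1 : 2 ^ k ^ 2 ≤ i) (h2 : i < 2 ^ (k + 1) ^ 2) :
    Nat.sqrt (Nat.log 2 i) = k := by
  have hi : i ≠ 0 := (lt_of_lt_of_le (by positivity) h1).ne'
  exact (Nat.eq_sqrt'.2 ⟨Nat.le_log_of_pow_le (by norm_num) h1, Nat.log_lt_of_lt_pow hi h2⟩).symm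

theorem monotone_sqrt_log : Monotone fun i => Nat.sqrt (Nat.log 2 i) := fun _ _ h =>
  Nat.sqrt_le_sqrt (Nat.log_mono_right h)

/-- A set missing infinitely many of the blocks `[2 ^ k², 2 ^ (k+1)²)` has lower density zero. -/
theorem lowerDensity_nonpos_of_frequently {A : Set ℕ}
    (h : ∃ᶠ k in atTop, ∀ i ∈ A, Nat.sqrt (Nat.log 2 i) ≠ k) : lowerDensity A ≤ 0 := by
  by_contra! hpos
  obtain ⟨c, hc, hcA⟩ := exists_between hpos
  have hev := eventually_lt_of_lt_liminf hcA (isBoundedUnder_ge_ncard_div A)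
  have hblocks : Tendsto (fun k : ℕ => 2 ^ (k + 1) ^ 2) atTop atTop :=
    tendsto_atTop_mono (fun k => (show k ≤ (k + 1) ^ 2 by nlinarith).trans
      Nat.lt_two_pow_self.le) tendsto_id
  have hsmall : ∀ᶠ k : ℕ in atTop, (1 / 2 : ℝ) ^ k < c :=
    (tendsto_pow_atTop_nhds_zero_of_lt_one (by norm_num) (by norm_num)).eventually_lt_const hc
  obtain ⟨k, hk, hk1, hk2⟩ := (h.and_eventually ((hblocks.eventually hev).and hsmall)).exists
  refine lt_irrefl c (hk1.trans_le (le_trans ?_ hk2.le))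
  -- At the end of a missed block only times before its start count, a proportion of at most `2 ^
  -- (-(2k + 1))`.
  have hsub : A ∩ Set.Iio (2 ^ (k + 1) ^ 2) ⊆ Set.Iio (2 ^ k ^ 2) := fun i hi => by
    by_contra hik
    exact hk i hi.1 (sqrt_log_eq (not_lt.1 hik) hi.2)
  have hcard : (A ∩ Set.Iio (2 ^ (k + 1) ^ 2)).ncard ≤ 2 ^ k ^ 2 := by
    simpa [Set.ncard_eq_toFinset_card'] using Set.ncard_le_ncard hsub (Set.finite_Iio _)
  rw [div_le_iff₀ (by positivity)]
  calc ((A ∩ Set.Iio (2 ^ (k + 1) ^ 2)).ncard : ℝ) ≤ 2 ^ k ^ 2 := by exact_mod_cast hcard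
    _ ≤ 2 ^ (k ^ 2 + k + 1) := pow_le_pow_right₀ (by norm_num) (by omega)
    _ = (1 / 2) ^ k * ((2 ^ (k + 1) ^ 2 : ℕ) : ℝ) := by
      rw [show (k + 1) ^ 2 = k + (k ^ 2 + k + 1) by ring]
      push_cast
      rw [pow_add _ k, ← mul_assoc, ← mul_pow]
      norm_num

theorem theorem8p7 {X : Type*} [MetricSpace X] [CompactSpace X] [Nontrivial X] (f : X → X)
    (hf : Continuous f) (hsurj : Function.Surjective f) (hequi : IsEquicontinuousMap f) :
    ¬ HasLowerDensityShadowing f ∧ ¬ HasUpperDensityShadowing f := by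
  constructor
  · refine not_hasFamilyShadowing_of_alternating hsurj hequi monotone_sqrt_log
      (fun n => Nat.sqrt_le_sqrt (Nat.log_le_self 2 n))
      (fun A hA => show ¬ 0 < lowerDensity A from not_lt.2 ?_)
      (fun A hA => show ¬ 0 < lowerDensity A from not_lt.2 ?_)
    · exact lowerDensity_nonpos_of_frequently
        (Nat.frequently_odd.mono fun k hk i hi he => Nat.not_even_iff_odd.2 hk (he ▸ hA hi))
    · exact lowerDensity_nonpos_of_frequently
        (Nat.frequently_even.mono fun k hk i hi he => hA hi (he.symm ▸ hk))
  · exact not_hasFamilyShadowing_of_alternating hsurj hequi (fun _ _ h => Nat.sqrt_le_sqrt h)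
      (fun _ => le_rfl) (fun A hA => show ¬ 1 / 2 < upperDensity A from
        not_lt.2 (upperDensity_le_half_of_subset_even_sqrt hA))
      (fun A hA => show ¬ 1 / 2 < upperDensity A from
        not_lt.2 (upperDensity_le_half_of_subset_not_even_sqrt hA))
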